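/- **Conventions.** All spaces are Hausdorff. For a locally compact space $X$ let $\mathscr O(X),\mathscr C(X),\mathscr K(X)$ be the families of open, closed and compact subsets. A *topological measure* on $X$ is a set function $\mu:\mathscr O(X)\cup\mathscr C(X)\to[0,\infty]$, not identically $\infty$, such that (a) $\mu(A\sqcup B)=\mu(A)+\mu(B)$ whenever $A,B,A\sqcup B\in\mathscr O(X)\cup\mathscr K(X)$; (b) $\mu(U)=\sup\{\mu(K):K\subseteq U,\ K\in\mathscr K(X)\}$ for $U\in\mathscr O(X)$; (c) $\mu(F)=\inf\{\mu(U):F\subseteq U,\ U\in\mathscr O(X)\}$ for $F\in\mathscr C(X)$. It is a *deficient topological measure* if (a) is required only for $A,B\in\mathscr K(X)$. It is *simple* if it assumes no values other than $0$ and $1$ (so the zero set function is simple). $X^\flat$ (resp. $X^\sharp$) is the set of simple deficient topological measures (resp. simple topological measures) on $X$, with the weak topology, the coarsest topology making $\mu\mapsto\int_X f\,d\mu$ continuous for every nonnegative $f\in C_0(X)$, where $\int_X f\,d\mu=\int_0^{\|f\|}\mu(\{x:f(x)>t\})\,dt$. For $A\in\mathscr O(X)\cup\mathscr K(X)$ put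 $A^\flat=\{\mu\in X^\flat:\mu(A)=1\}$ and $A^\sharp=\{\mu\in X^\sharp:\mu(A)=1\}$, and let $\Lambda(A)=A^\flat$ (resp. $\Lambda(A)=A^\sharp$). A map $q:\mathscr O(X)\cup\mathscr K(X)\to\mathscr O(Y)\cup\mathscr K(Y)$ is an *image transformation* from $X$ to $Y$ if (1) $q(U)\in\mathscr O(Y)$ for $U\in\mathscr O(X)$ and $q(K)\in\mathscr K(Y)$ for $K\in\mathscr K(X)$; (2) $q(U)=\bigcup\{q(K):K\subseteq U,\ K\in\mathscr K(X)\}$ for $U\in\mathscr O(X)$; (3) $q(K)=\bigcap\{q(U):K\subseteq U,\ U\in\mathscr O(X)\}$ for $K\in\mathscr K(X)$; (4) $q(A\sqcup B)=q(A)\sqcup q(B)$ whenever $A,B,A\sqcup B\in\mathscr O(X)\cup\mathscr K(X)$. It is a *d-image transformation* if (4) is required only for $A,B\in\mathscr K(X)$. The adjoint $q^*$ sends a set function $\nu$ on $\mathscr O(Y)\cup\mathscr C(Y)$ to the set function on $\mathscr O(X)\cup\mathscr C(X)$ given by $(q^*\nu)(A)=\nu(q(A))$ for $A\in\mathscr O(X)\cup\mathscr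 K(X)$ and $(q^*\nu)(F)=\inf\{\nu(q(U)):F\subseteq U,\ U\in\mathscr O(X)\}$ for all other closed $F$; $i_Y(y)=\delta_y$ is the point mass at $y$. A map $w:Y\to X^\flat$ (resp. $w:Y\to X^\sharp$) is *k-proper* if $w^{-1}(K^\flat)$ (resp. $w^{-1}(K^\sharp)$) is compact for every $K\in\mathscr K(X)$. **Theorem.** Let $X$ and $Y$ be locally compact Hausdorff spaces. (I) If $q$ is a d-image transformation (resp. an image transformation) from $X$ to $Y$, then $w=q^*\circ i_Y$ takes its values in $X^\flat$ (resp. $X^\sharp$), it is continuous and k-proper, and $q=w^{-1}\circ\Lambda$. (II) If $w:Y\to X^\flat$ (resp. $w:Y\to X^\sharp$) is continuous and k-proper, then $q=w^{-1}\circ\Lambda$ is a d-image transformation (resp. an image transformation) from $X$ to $Y$, and $w=q^*\circ i_Y$. Thus $q\mapsto q^*\circ i_Y$ is a bijection, with inverse $w\mapsto w^{-1}\circ\Lambda$, from the d-image transformations (resp. image transformations) from $X$ to $Y$ onto the continuous k-proper maps $Y\to X^\flat$ (resp. $Y\to X^\sharp$). In this bijection $q$ is not identically $\emptyset$ if and only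 if $w$ is not identically the zero set function. -/

import Mathlib

/-!
A map `w` from `Y` to the simple set functions on `X` and a transformation `q` are two curryings of
the same relation `y ∈ q A ↔ w y A = 1` between points of `Y` and open or compact subsets of `X`.
Since a simple set function only takes the values `0` and `1`, regularity and additivity of every
`w y` say, read off at the sets where the value is `1`, exactly that `q` commutes with the
corresponding unions and intersections. The topological conditions match as well: the integral of
`f` against a simple `μ` is determined by the level `t` at which `μ {f > t}` drops from `1` to `0`,
so `w` is continuous as soon as the preimages of the sets `{μ | μ U = 1}` are open and those of the
sets `{μ | μ K = 1}` are closed, and conversely a Urysohn function shows that `{μ | μ U = 1}` is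
open when `X` is locally compact.
-/

open scoped ENNReal ZeroAtInfty Topology

/-- The family of all sets that are open or closed. -/
abbrev OpenOrClosed (X : Type*) [TopologicalSpace X] : Type _ :=
  {A : Set X // IsOpen A ∨ IsClosed A}

/-- The family of all sets that are open or compact. -/
abbrev OpenOrCompact (X : Type*) [TopologicalSpace X] : Type _ :=
  {A : Set X // IsOpen A ∨ IsCompact A}

/-- In a Hausdorff space, an open or compact set is open or closed. -/
def OpenOrCompact.toOpenOrClosed {X : Type*} [TopologicalSpace X] [T2Space X]
    (A : OpenOrCompact X) : OpenOrClosed X :=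
  ⟨A.1, A.2.imp id IsCompact.isClosed⟩

/-- The whole space as an open set. -/
def OpenOrClosed.whole (X : Type*) [TopologicalSpace X] : OpenOrClosed X :=
  ⟨Set.univ, Or.inl isOpen_univ⟩

/-- A topological measure: a `[0, ∞]`-valued function on the open and the closed sets, not
identically `∞`, additive on disjoint open or compact sets whose union is open or compact, inner
regular on open sets and outer regular on closed sets. -/
structure IsTopologicalMeasure {X : Type*} [TopologicalSpace X]
    (μ : OpenOrClosed X → ℝ≥0∞) : Prop where
  exists_ne_top : ∃ A, μ A ≠ ∞
  add : ∀ A B C : OpenOrClosed X,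
    (IsOpen A.1 ∨ IsCompact A.1) → (IsOpen B.1 ∨ IsCompact B.1) → (IsOpen C.1 ∨ IsCompact C.1) →
    Disjoint A.1 B.1 → C.1 = A.1 ∪ B.1 → μ C = μ A + μ B
  inner : ∀ U : OpenOrClosed X, IsOpen U.1 →
    μ U = ⨆ (K : OpenOrClosed X) (_ : IsCompact K.1 ∧ K.1 ⊆ U.1), μ K
  outer : ∀ F : OpenOrClosed X, IsClosed F.1 →
    μ F = ⨅ (U : OpenOrClosed X) (_ : IsOpen U.1 ∧ F.1 ⊆ U.1), μ U

/-- A deficient topological measure: additivity is only required for disjoint compact sets. -/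
structure IsDeficientTopologicalMeasure {X : Type*} [TopologicalSpace X]
    (μ : OpenOrClosed X → ℝ≥0∞) : Prop where
  exists_ne_top : ∃ A, μ A ≠ ∞
  add : ∀ A B C : OpenOrClosed X, IsCompact A.1 → IsCompact B.1 →
    Disjoint A.1 B.1 → C.1 = A.1 ∪ B.1 → μ C = μ A + μ B
  inner : ∀ U : OpenOrClosed X, IsOpen U.1 →
    μ U = ⨆ (K : OpenOrClosed X) (_ : IsCompact K.1 ∧ K.1 ⊆ U.1), μ K
  outer : ∀ F : OpenOrClosed X, IsClosed F.1 →
    μ F = ⨅ (U : OpenOrClosed X) (_ : IsOpen U.1 ∧ F.1 ⊆ U.1), μ U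

theorem IsTopologicalMeasure.deficient {X : Type*} [TopologicalSpace X]
    {μ : OpenOrClosed X → ℝ≥0∞} (h : IsTopologicalMeasure μ) :
    IsDeficientTopologicalMeasure μ where
  exists_ne_top := h.exists_ne_top
  add A B C hA hB hd hC :=
    h.add A B C (Or.inr hA) (Or.inr hB) (Or.inr (hC ▸ hA.union hB)) hd hC
  inner := h.inner
  outer := h.outer

/-- The space `𝐃𝐓𝐌(X)` of all finite deficient topological measures on `X`. -/
def FiniteDTM (X : Type*) [TopologicalSpace X] : Type _ :=
  {μ : OpenOrClosed X → ℝ≥0∞ // IsDeficientTopologicalMeasure μ ∧ μ (OpenOrClosed.whole X) ≠ ∞}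

/-- The cone `C₀⁺(X)` of nonnegative continuous functions vanishing at infinity. -/
abbrev NonnegC0 (X : Type*) [TopologicalSpace X] : Type _ :=
  {f : C₀(X, ℝ) // ∀ x, 0 ≤ f x}

/-- The quasi-integral `∫ f dμ = ∫₀ᵇ μ({x : f x > t}) dt` of `f ∈ C₀⁺(X)`, where `[0, b]`
contains the range of `f`; here `b = ‖f‖`. -/
noncomputable def quasiIntegral {X : Type*} [TopologicalSpace X] (μ : FiniteDTM X)
    (f : NonnegC0 X) : ℝ :=
  ∫ t in (0 : ℝ)..‖f.1‖,
    (μ.1 ⟨{x | t < f.1 x}, Or.inl (isOpen_lt continuous_const (map_continuous f.1))⟩).toReal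

/-- The weak topology: the coarsest one making all `μ ↦ ∫ f dμ`, `f ∈ C₀⁺(X)`, continuous. -/
noncomputable instance FiniteDTM.instTopologicalSpace (X : Type*) [TopologicalSpace X] :
    TopologicalSpace (FiniteDTM X) :=
  ⨅ f : NonnegC0 X, TopologicalSpace.induced (fun μ => quasiIntegral μ f) inferInstance

/-- A set function is simple if it only assumes the values `0` and `1`. -/
def IsSimpleSetFunction {X : Type*} [TopologicalSpace X] (μ : OpenOrClosed X → ℝ≥0∞) : Prop :=
  ∀ A, μ A = 0 ∨ μ A = 1

/-- The set `X^♭` of simple deficient topological measures on `X`, a subspace of `𝐃𝐓𝐌(X)`. -/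
def SimpleDTM (X : Type*) [TopologicalSpace X] : Set (FiniteDTM X) :=
  {μ | IsSimpleSetFunction μ.1}

/-- The set `X^♯` of simple topological measures on `X`, a subspace of `𝐃𝐓𝐌(X)`. -/
def SimpleTM (X : Type*) [TopologicalSpace X] : Set (FiniteDTM X) :=
  {μ | IsTopologicalMeasure μ.1 ∧ IsSimpleSetFunction μ.1}

/-- The map `Λ : A ↦ {μ ∈ S : μ(A) = 1}` on open or compact sets. For `S = X^♭` it is the basic
d-image transformation `A ↦ A^♭`, for `S = X^♯` the basic image transformation `A ↦ A^♯`. -/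
def basicTransformation {X : Type*} [TopologicalSpace X] [T2Space X] (S : Set (FiniteDTM X))
    (A : OpenOrCompact X) : Set S :=
  {μ | μ.1.1 A.toOpenOrClosed = 1}

/-- For `S = X^♭` or `S = X^♯`, a map `w : Y → S` is k-proper if the preimage of `K^♭`
(resp. `K^♯`) is compact for every compact `K ⊆ X`. -/
def IsKProper {X Y : Type*} [TopologicalSpace X] [T2Space X] [TopologicalSpace Y]
    {S : Set (FiniteDTM X)} (w : Y → S) : Prop :=
  ∀ K : OpenOrCompact X, IsCompact K.1 → IsCompact (w ⁻¹' basicTransformation S K)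

/-- A d-image transformation from `X` to `Y`. -/
structure IsDImageTransformation {X Y : Type*} [TopologicalSpace X] [TopologicalSpace Y]
    (q : OpenOrCompact X → OpenOrCompact Y) : Prop where
  isOpen : ∀ U : OpenOrCompact X, IsOpen U.1 → IsOpen (q U).1
  isCompact : ∀ K : OpenOrCompact X, IsCompact K.1 → IsCompact (q K).1
  inner : ∀ U : OpenOrCompact X, IsOpen U.1 →
    (q U).1 = ⋃ (K : OpenOrCompact X) (_ : IsCompact K.1 ∧ K.1 ⊆ U.1), (q K).1
  outer : ∀ K : OpenOrCompact X, IsCompact K.1 →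
    (q K).1 = ⋂ (U : OpenOrCompact X) (_ : IsOpen U.1 ∧ K.1 ⊆ U.1), (q U).1
  disjoint_union : ∀ A B C : OpenOrCompact X, IsCompact A.1 → IsCompact B.1 →
    Disjoint A.1 B.1 → C.1 = A.1 ∪ B.1 →
    Disjoint (q A).1 (q B).1 ∧ (q C).1 = (q A).1 ∪ (q B).1

/-- An image transformation from `X` to `Y`: here disjoint unions are preserved for all open or
compact sets whose union is again open or compact. -/
structure IsImageTransformation {X Y : Type*} [TopologicalSpace X] [TopologicalSpace Y]
    (q : OpenOrCompact X → OpenOrCompact Y) : Prop where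
  isOpen : ∀ U : OpenOrCompact X, IsOpen U.1 → IsOpen (q U).1
  isCompact : ∀ K : OpenOrCompact X, IsCompact K.1 → IsCompact (q K).1
  inner : ∀ U : OpenOrCompact X, IsOpen U.1 →
    (q U).1 = ⋃ (K : OpenOrCompact X) (_ : IsCompact K.1 ∧ K.1 ⊆ U.1), (q K).1
  outer : ∀ K : OpenOrCompact X, IsCompact K.1 →
    (q K).1 = ⋂ (U : OpenOrCompact X) (_ : IsOpen U.1 ∧ K.1 ⊆ U.1), (q U).1
  disjoint_union : ∀ A B C : OpenOrCompact X,
    Disjoint A.1 B.1 → C.1 = A.1 ∪ B.1 →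
    Disjoint (q A).1 (q B).1 ∧ (q C).1 = (q A).1 ∪ (q B).1

open Classical in
/-- The adjoint `q^*`: `(q^* ν)(A) = ν(q(A))` for `A` open or compact, and
`(q^* ν)(F) = inf {(q^* ν)(U) : U open, F ⊆ U}` for the remaining closed sets `F`. -/
noncomputable def imageAdjoint {X Y : Type*} [TopologicalSpace X] [TopologicalSpace Y] [T2Space Y]
    (q : OpenOrCompact X → OpenOrCompact Y) (ν : OpenOrClosed Y → ℝ≥0∞) :
    OpenOrClosed X → ℝ≥0∞ := fun A =>
  if hA : IsOpen A.1 ∨ IsCompact A.1 then ν (q ⟨A.1, hA⟩).toOpenOrClosed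
  else ⨅ (U : OpenOrCompact X) (_ : IsOpen U.1 ∧ A.1 ⊆ U.1), ν (q U).toOpenOrClosed

open Classical in
/-- The set function `A ↦ 1` if `y ∈ A`, and `A ↦ 0` otherwise. -/
noncomputable def pointMassFun {Y : Type*} [TopologicalSpace Y] (y : Y) :
    OpenOrClosed Y → ℝ≥0∞ := fun A => if y ∈ A.1 then 1 else 0

theorem isTopologicalMeasure_pointMassFun {Y : Type*} [TopologicalSpace Y] [T2Space Y] (y : Y) :
    IsTopologicalMeasure (pointMassFun y) where
  exists_ne_top := ⟨OpenOrClosed.whole Y, by simp [pointMassFun, OpenOrClosed.whole]⟩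
  add A B C _ _ _ hd hC := by
    have hd' : y ∈ A.1 → y ∉ B.1 := fun h => Set.disjoint_left.1 hd h
    by_cases hA : y ∈ A.1
    · simp [pointMassFun, hC, hA, hd' hA]
    · have hCB : y ∈ C.1 ↔ y ∈ B.1 := by simp [hC, hA]
      by_cases hB : y ∈ B.1 <;> simp [pointMassFun, hCB, hA, hB]
  inner U _ := by
    apply le_antisymm
    · by_cases hU : y ∈ U.1
      · refine le_trans (le_of_eq ?_) (le_iSup₂ (f := fun (K : OpenOrClosed Y)
          (_ : IsCompact K.1 ∧ K.1 ⊆ U.1) => pointMassFun y K)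
          ⟨{y}, Or.inr isClosed_singleton⟩ ⟨isCompact_singleton, by simpa using hU⟩)
        simp [pointMassFun, hU]
      · simp [pointMassFun, hU]
    · refine iSup₂_le fun K hK => ?_
      by_cases hy : y ∈ K.1
      · simp [pointMassFun, hy, hK.2 hy]
      · simp [pointMassFun, hy]
  outer F _ := by
    apply le_antisymm
    · refine le_iInf₂ fun U hU => ?_
      by_cases hy : y ∈ F.1
      · simp [pointMassFun, hy, hU.2 hy]
      · simp [pointMassFun, hy]
    · by_cases hF : y ∈ F.1
      · refine le_trans (iInf₂_le (OpenOrClosed.whole Y) ⟨isOpen_univ, Set.subset_univ _⟩) ?_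
        simp [pointMassFun, hF, OpenOrClosed.whole]
      · refine le_trans (iInf₂_le ⟨{y}ᶜ, Or.inl isOpen_compl_singleton⟩
          ⟨isOpen_compl_singleton, fun z hz hzy => hF (hzy ▸ hz)⟩) ?_
        simp [pointMassFun]

/-- The map `i_Y : Y → 𝐃𝐓𝐌(Y)`, `y ↦ δ_y`. -/
noncomputable def pointMass {Y : Type*} [TopologicalSpace Y] [T2Space Y] (y : Y) : FiniteDTM Y :=
  ⟨pointMassFun y, (isTopologicalMeasure_pointMassFun y).deficient,
    by simp [pointMassFun, OpenOrClosed.whole]⟩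

/-- The values allowed for a simple set function, for which suprema, infima and sums can be
computed from the sole knowledge of which terms are equal to `1`. -/
def IsZeroOne (a : ℝ≥0∞) : Prop := a = 0 ∨ a = 1

namespace IsZeroOne

variable {ι : Type*} {p : ι → Prop} {f : ι → ℝ≥0∞} {a b c : ℝ≥0∞}

theorem le_one (ha : IsZeroOne a) : a ≤ 1 := by
  rcases ha with rfl | rfl <;> simp

theorem eq_one_of_le (ha : IsZeroOne a) (h : b ≤ a) (hb : b = 1) : a = 1 :=
  le_antisymm ha.le_one (hb ▸ h)

theorem eq_iff (ha : IsZeroOne a) (hb : IsZeroOne b) : a = b ↔ (a = 1 ↔ b = 1) := by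
  rcases ha with rfl | rfl <;> rcases hb with rfl | rfl <;> simp

theorem eq_add_iff (ha : IsZeroOne a) (hb : IsZeroOne b) (hc : IsZeroOne c) :
    c = a + b ↔ (a = 1 → b ≠ 1) ∧ (c = 1 ↔ a = 1 ∨ b = 1) := by
  rcases ha with rfl | rfl <;> rcases hb with rfl | rfl <;> rcases hc with rfl | rfl <;> norm_num

theorem biSup_eq_one_iff (hf : ∀ i, IsZeroOne (f i)) :
    ⨆ (i) (_ : p i), f i = 1 ↔ ∃ i, p i ∧ f i = 1 := by
  constructor
  · intro h
    by_contra! hne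
    have : ⨆ (i) (_ : p i), f i ≤ 0 := iSup₂_le fun i hi ↦ ((hf i).resolve_right (hne i hi)).le
    exact absurd (h ▸ this) (by simp)
  · rintro ⟨i, hi, h⟩
    exact le_antisymm (iSup₂_le fun j _ ↦ (hf j).le_one) (h ▸ le_iSup₂ (f := fun i _ ↦ f i) i hi)

theorem biSup (hf : ∀ i, IsZeroOne (f i)) : IsZeroOne (⨆ (i) (_ : p i), f i) := by
  refine or_iff_not_imp_right.2 fun h ↦ ?_
  rw [biSup_eq_one_iff hf] at h
  push Not at h
  exact le_antisymm (iSup₂_le fun i hi ↦ ((hf i).resolve_right (h i hi)).le) zero_le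

theorem biInf_eq_one_iff (hp : ∃ i, p i) (hf : ∀ i, IsZeroOne (f i)) :
    ⨅ (i) (_ : p i), f i = 1 ↔ ∀ i, p i → f i = 1 := by
  constructor
  · exact fun h i hi ↦ (hf i).eq_one_of_le (iInf₂_le i hi) h
  · obtain ⟨i, hi⟩ := hp
    exact fun h ↦ le_antisymm (iInf₂_le_of_le i hi (hf i).le_one) (le_iInf₂ fun j hj ↦ (h j hj).ge)

theorem biInf (hp : ∃ i, p i) (hf : ∀ i, IsZeroOne (f i)) : IsZeroOne (⨅ (i) (_ : p i), f i) := by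
  refine or_iff_not_imp_right.2 fun h ↦ ?_
  rw [biInf_eq_one_iff hp hf] at h
  push Not at h
  obtain ⟨i, hi, hne⟩ := h
  exact le_antisymm (iInf₂_le_of_le i hi ((hf i).resolve_right hne).le) zero_le

end IsZeroOne

namespace IsSimpleSetFunction

variable {X : Type*} [TopologicalSpace X] {μ : OpenOrClosed X → ℝ≥0∞}

theorem isZeroOne (hs : IsSimpleSetFunction μ) (A : OpenOrClosed X) : IsZeroOne (μ A) := hs A

theorem ne_top (hs : IsSimpleSetFunction μ) (A : OpenOrClosed X) : μ A ≠ ∞ :=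
  ne_top_of_le_ne_top ENNReal.one_ne_top (hs.isZeroOne A).le_one

theorem eq_biSup_iff (hs : IsSimpleSetFunction μ) (A : OpenOrClosed X)
    {p : OpenOrClosed X → Prop} :
    μ A = ⨆ (B) (_ : p B), μ B ↔ (μ A = 1 ↔ ∃ B, p B ∧ μ B = 1) := by
  rw [(hs.isZeroOne A).eq_iff (.biSup hs.isZeroOne), IsZeroOne.biSup_eq_one_iff hs.isZeroOne]

theorem eq_biInf_iff (hs : IsSimpleSetFunction μ) (A : OpenOrClosed X)
    {p : OpenOrClosed X → Prop} (hp : ∃ B, p B) :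
    μ A = ⨅ (B) (_ : p B), μ B ↔ (μ A = 1 ↔ ∀ B, p B → μ B = 1) := by
  rw [(hs.isZeroOne A).eq_iff (.biInf hp hs.isZeroOne), IsZeroOne.biInf_eq_one_iff hp hs.isZeroOne]

end IsSimpleSetFunction

theorem OpenOrClosed.exists_isOpen_superset {X : Type*} [TopologicalSpace X] (A : Set X) :
    ∃ U : OpenOrClosed X, IsOpen U.1 ∧ A ⊆ U.1 :=
  ⟨.whole X, isOpen_univ, Set.subset_univ A⟩

namespace IsDeficientTopologicalMeasure

variable {X : Type*} [TopologicalSpace X] {μ ν : OpenOrClosed X → ℝ≥0∞}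

theorem le_of_subset_isOpen (h : IsDeficientTopologicalMeasure μ) {A U : OpenOrClosed X}
    (hU : IsOpen U.1) (hAU : A.1 ⊆ U.1) : μ A ≤ μ U := by
  rcases A.2 with hA | hA
  · rw [h.inner A hA, h.inner U hU]
    exact biSup_mono fun K hK ↦ ⟨hK.1, hK.2.trans hAU⟩
  · rw [h.outer A hA]
    exact iInf₂_le U ⟨hU, hAU⟩

theorem mono (h : IsDeficientTopologicalMeasure μ) {A B : OpenOrClosed X} (hAB : A.1 ⊆ B.1) :
    μ A ≤ μ B := by
  rcases B.2 with hB | hB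
  · exact h.le_of_subset_isOpen hB hAB
  · rw [h.outer B hB]
    exact le_iInf₂ fun U hU ↦ h.le_of_subset_isOpen hU.1 (hAB.trans hU.2)

theorem eq_of_forall_isOpen (hμ : IsDeficientTopologicalMeasure μ)
    (hν : IsDeficientTopologicalMeasure ν) (h : ∀ U, IsOpen U.1 → μ U = ν U) : μ = ν := by
  funext A
  rcases A.2 with hA | hA
  · exact h A hA
  · rw [hμ.outer A hA, hν.outer A hA]
    exact iInf_congr fun U ↦ iInf_congr fun hU ↦ h U hU.1

theorem eq_zero_of_eq_empty (h : IsDeficientTopologicalMeasure μ) (hs : IsSimpleSetFunction μ)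
    {A : OpenOrClosed X} (hA : A.1 = ∅) : μ A = 0 := by
  have hc : IsCompact A.1 := hA ▸ isCompact_empty
  have hadd : μ A = μ A + μ A := h.add A A A hc hc (by simp [hA]) (by simp)
  have hne : μ A = 1 → μ A ≠ 1 :=
    (((hs.isZeroOne A).eq_add_iff (hs.isZeroOne A) (hs.isZeroOne A)).1 hadd).1
  exact (hs A).resolve_right fun h1 ↦ hne h1 h1

end IsDeficientTopologicalMeasure

section QuasiIntegral

open MeasureTheory intervalIntegral

theorem lt_integral_iff_of_antitone_of_eq_zero_or_one {g : ℝ → ℝ} (hg : Antitone g)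
    (h01 : ∀ t, g t = 0 ∨ g t = 1) {b s : ℝ} (hb : g b = 0) (hs : 0 ≤ s) :
    s < ∫ t in 0..b, g t ↔ ∃ t, s < t ∧ g t = 1 := by
  have hint (c d : ℝ) : IntervalIntegrable g volume c d := hg.intervalIntegrable
  have hnonneg (t : ℝ) : 0 ≤ g t := by rcases h01 t with h | h <;> simp [h]
  have hle (t : ℝ) : g t ≤ 1 := by rcases h01 t with h | h <;> simp [h]
  constructor
  · intro hlt
    by_contra! hne
    have hzero : ∫ t in s..b, g t = 0 := integral_zero_ae <| .of_forall fun t ht ↦ by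
      rcases min_lt_iff.1 ht.1 with hst | hbt
      · exact (h01 t).resolve_right (hne t hst)
      · exact le_antisymm (hb ▸ hg hbt.le) (hnonneg t)
    have hbound : ∫ t in 0..s, g t ≤ s := by
      simpa using integral_mono_on hs (hint 0 s) intervalIntegrable_const fun t _ ↦ hle t
    have := integral_add_adjacent_intervals (hint 0 s) (hint s b)
    linarith
  · rintro ⟨t, hst, ht⟩
    have htb : t ≤ b := le_of_not_gt fun hbt ↦ by
      have := hg hbt.le
      linarith
    have hone : t ≤ ∫ u in 0..t, g u := by
      simpa using integral_mono_on (f := fun _ ↦ 1) (hs.trans hst.le) intervalIntegrable_const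
        (hint 0 t) fun u hu ↦ ht ▸ hg hu.2
    have hrest : 0 ≤ ∫ u in t..b, g u := integral_nonneg htb fun u _ ↦ hnonneg u
    have := integral_add_adjacent_intervals (hint 0 t) (hint t b)
    linarith

variable {X : Type*} [TopologicalSpace X]

/-- The open set `{f > t}`, whose measure is integrated over `t` in `quasiIntegral`. -/
def superlevel (f : NonnegC0 X) (t : ℝ) : OpenOrClosed X :=
  ⟨{x | t < f.1 x}, .inl (isOpen_lt continuous_const (map_continuous f.1))⟩

theorem superlevel_norm_eq_empty (f : NonnegC0 X) : (superlevel f ‖f.1‖).1 = ∅ :=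
  Set.eq_empty_of_forall_notMem fun x (hx : ‖f.1‖ < f.1 x) ↦
    hx.not_ge ((le_abs_self _).trans (f.1.toBCF.norm_coe_le_norm x))

theorem isCompact_setOf_le (f : C₀(X, ℝ)) {t : ℝ} (ht : 0 < t) : IsCompact {x | t ≤ f x} := by
  have hlt : ∀ᶠ x in Filter.cocompact X, f x < t := (zero_at_infty f).eventually (gt_mem_nhds ht)
  obtain ⟨K, hK, hKt⟩ := Filter.mem_cocompact'.1 hlt
  exact hK.of_isClosed_subset (isClosed_le continuous_const (map_continuous f))
    fun x hx ↦ hKt fun hxt : f x < t ↦ hxt.not_ge hx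

theorem quasiIntegral_nonneg (μ : FiniteDTM X) (f : NonnegC0 X) : 0 ≤ quasiIntegral μ f :=
  integral_nonneg (norm_nonneg _) fun _ _ ↦ ENNReal.toReal_nonneg

theorem continuous_quasiIntegral (f : NonnegC0 X) :
    Continuous fun μ : FiniteDTM X ↦ quasiIntegral μ f :=
  continuous_iff_le_induced.2 (iInf_le _ f)

theorem lt_quasiIntegral_iff {μ : FiniteDTM X} (hμ : μ ∈ SimpleDTM X) (f : NonnegC0 X) {s : ℝ}
    (hs : 0 ≤ s) : s < quasiIntegral μ f ↔ ∃ t, s < t ∧ μ.1 (superlevel f t) = 1 := by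
  have hsimple : IsSimpleSetFunction μ.1 := hμ
  have hanti : Antitone fun t ↦ (μ.1 (superlevel f t)).toReal := fun t u htu ↦
    ENNReal.toReal_mono (hsimple.ne_top _) (μ.2.1.mono fun x hx ↦ htu.trans_lt hx)
  have h01 (t : ℝ) :
      (μ.1 (superlevel f t)).toReal = 0 ∨ (μ.1 (superlevel f t)).toReal = 1 := by
    rcases hsimple (superlevel f t) with h | h <;> simp [h]
  have hzero : (μ.1 (superlevel f ‖f.1‖)).toReal = 0 := by
    simp [μ.2.1.eq_zero_of_eq_empty hsimple (superlevel_norm_eq_empty f)]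
  have key := lt_integral_iff_of_antitone_of_eq_zero_or_one hanti h01 hzero hs
  simp only [ENNReal.toReal_eq_one_iff] at key
  exact key

theorem le_quasiIntegral_iff [T2Space X] {μ : FiniteDTM X} (hμ : μ ∈ SimpleDTM X) (f : NonnegC0 X)
    {s : ℝ} : s ≤ quasiIntegral μ f ↔ ∀ t (ht : 0 < t), t < s →
      μ.1 (OpenOrCompact.toOpenOrClosed ⟨_, .inr (isCompact_setOf_le f.1 ht)⟩) = 1 := by
  have hsimple : IsSimpleSetFunction μ.1 := hμ
  constructor
  · intro h t ht hts
    obtain ⟨u, htu, hu⟩ := (lt_quasiIntegral_iff hμ f ht.le).1 (hts.trans_le h)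
    have hsub : (superlevel f u).1 ⊆ {x | t ≤ f.1 x} := fun x hx ↦ (htu.trans hx).le
    exact (hsimple.isZeroOne _).eq_one_of_le (μ.2.1.mono hsub) hu
  · intro h
    by_contra! hlt
    obtain ⟨t, ht, hts⟩ := exists_between hlt
    obtain ⟨u, hu, hut⟩ := exists_between ht
    have hn := quasiIntegral_nonneg μ f
    have hsub : {x | t ≤ f.1 x} ⊆ (superlevel f u).1 := fun x hx ↦ hut.trans_le hx
    exact lt_irrefl _ ((lt_quasiIntegral_iff hμ f hn).2 ⟨u, hu, (hsimple.isZeroOne _).eq_one_of_le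
      (μ.2.1.mono hsub) (h t (hn.trans_lt ht) hts)⟩)

end QuasiIntegral

section WeakTopology

variable {X Y : Type*} [TopologicalSpace X] [T2Space X] {S : Set (FiniteDTM X)}

theorem mem_basicTransformation {A : OpenOrCompact X} {μ : S} :
    μ ∈ basicTransformation S A ↔ μ.1.1 A.toOpenOrClosed = 1 := .rfl

theorem isOpen_basicTransformation [LocallyCompactSpace X] (hS : S ⊆ SimpleDTM X)
    {U : OpenOrCompact X} (hU : IsOpen U.1) : IsOpen (basicTransformation S U) := by
  rw [isOpen_iff_mem_nhds]
  rintro ⟨μ, hμ⟩ (hμU : μ.1 U.toOpenOrClosed = 1)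
  have hsimple (ν : S) : IsSimpleSetFunction ν.1.1 := hS ν.2
  obtain ⟨K, ⟨hKc, hKU⟩, hK1⟩ :=
    (((hsimple ⟨μ, hμ⟩).eq_biSup_iff _).1 (μ.2.1.inner U.toOpenOrClosed hU)).1 hμU
  obtain ⟨g, hgK, hgU, hgc, hg01⟩ := exists_continuous_one_zero_of_isCompact hKc hU.isClosed_compl
    (Set.disjoint_compl_right_iff_subset.2 hKU)
  let f : NonnegC0 X := ⟨⟨g, hgc.is_zero_at_infty⟩, fun x ↦ (hg01 x).1⟩
  have hopen : IsOpen {ν : S | 0 < quasiIntegral ν.1 f} :=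
    isOpen_lt continuous_const ((continuous_quasiIntegral f).comp continuous_subtype_val)
  have hKf : K.1 ⊆ (superlevel f (1 / 2)).1 := fun x hx ↦ by
    change 1 / 2 < g x
    norm_num [hgK hx]
  have hfU (t : ℝ) (ht : 0 < t) : (superlevel f t).1 ⊆ U.1 := fun x (hx : t < g x) ↦ by
    by_contra hxU
    exact (ht.trans hx).ne' (hgU hxU)
  refine Filter.mem_of_superset (hopen.mem_nhds ?_) fun ν hν ↦ ?_
  · exact (lt_quasiIntegral_iff (hS hμ) f le_rfl).2 ⟨1 / 2, by norm_num,
      ((hsimple ⟨μ, hμ⟩).isZeroOne _).eq_one_of_le (μ.2.1.mono hKf) hK1⟩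
  · obtain ⟨t, ht0, ht⟩ := (lt_quasiIntegral_iff (hS ν.2) f le_rfl).1 hν
    exact ((hsimple ν).isZeroOne _).eq_one_of_le (ν.1.2.1.mono (hfU t ht0)) ht

theorem continuous_of_isOpen_of_isClosed [TopologicalSpace Y] (hS : S ⊆ SimpleDTM X) {w : Y → S}
    (hopen : ∀ U : OpenOrCompact X, IsOpen U.1 → IsOpen (w ⁻¹' basicTransformation S U))
    (hclosed : ∀ K : OpenOrCompact X, IsCompact K.1 → IsClosed (w ⁻¹' basicTransformation S K)) :
    Continuous w := by
  refine continuous_induced_rng.2 <| continuous_iInf_rng.2 fun f ↦ continuous_induced_rng.2 <|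
    continuous_iff_lower_upperSemicontinuous.2
      ⟨lowerSemicontinuous_iff_isOpen_preimage.2 fun s ↦ ?_,
        upperSemicontinuous_iff_isClosed_preimage.2 fun s ↦ ?_⟩
  · rcases lt_or_ge s 0 with hs | hs
    · convert isOpen_univ
      exact Set.eq_univ_of_forall fun y ↦ hs.trans_le (quasiIntegral_nonneg _ f)
    · convert isOpen_biUnion fun t (_ : s < t) ↦
        hopen ⟨(superlevel f t).1, .inl (isOpen_lt continuous_const (map_continuous f.1))⟩
          (isOpen_lt continuous_const (map_continuous f.1))
      ext y
      simpa [mem_basicTransformation] using! lt_quasiIntegral_iff (hS (w y).2) f hs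
  · convert isClosed_iInter fun t ↦ isClosed_iInter fun ht : 0 < t ↦ isClosed_iInter
      fun _ : t < s ↦ hclosed ⟨_, .inr (isCompact_setOf_le f.1 ht)⟩ (isCompact_setOf_le f.1 ht)
    ext y
    simpa [mem_basicTransformation] using! le_quasiIntegral_iff (hS (w y).2) f

end WeakTopology

section Transformations

variable {X Y : Type*} [TopologicalSpace X] [TopologicalSpace Y]
  {q : OpenOrCompact X → OpenOrCompact Y}

theorem pointMass_eq_one_iff [T2Space Y] {y : Y} {A : OpenOrClosed Y} :
    (pointMass y).1 A = 1 ↔ y ∈ A.1 := by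
  simp [pointMass, pointMassFun]

theorem isSimpleSetFunction_pointMass [T2Space Y] (y : Y) :
    IsSimpleSetFunction (pointMass y).1 := fun A ↦ by
  by_cases hy : y ∈ A.1 <;> simp [pointMass, pointMassFun, hy]

theorem imageAdjoint_of_isOpen_or_isCompact [T2Space Y] (q : OpenOrCompact X → OpenOrCompact Y)
    (ν : OpenOrClosed Y → ℝ≥0∞) {A : OpenOrClosed X} (hA : IsOpen A.1 ∨ IsCompact A.1) :
    imageAdjoint q ν A = ν (q ⟨A.1, hA⟩).toOpenOrClosed :=
  dif_pos hA

theorem imageAdjoint_eq_biInf_of_not [T2Space Y] (q : OpenOrCompact X → OpenOrCompact Y)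
    (ν : OpenOrClosed Y → ℝ≥0∞) {F : OpenOrClosed X} (hF : ¬ (IsOpen F.1 ∨ IsCompact F.1)) :
    imageAdjoint q ν F =
      ⨅ (U : OpenOrClosed X) (_ : IsOpen U.1 ∧ F.1 ⊆ U.1), imageAdjoint q ν U := by
  rw [imageAdjoint, dif_neg hF]
  refine le_antisymm (le_iInf₂ fun U hU ↦ ?_) (le_iInf₂ fun U hU ↦ ?_)
  · rw [imageAdjoint_of_isOpen_or_isCompact q ν (.inl hU.1)]
    exact iInf₂_le (⟨U.1, .inl hU.1⟩ : OpenOrCompact X) hU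
  · refine (iInf₂_le (⟨U.1, .inl hU.1⟩ : OpenOrClosed X) hU).trans_eq ?_
    exact imageAdjoint_of_isOpen_or_isCompact q ν (.inl hU.1)

theorem IsSimpleSetFunction.imageAdjoint [T2Space Y] {ν : OpenOrClosed Y → ℝ≥0∞}
    (hν : IsSimpleSetFunction ν) (q : OpenOrCompact X → OpenOrCompact Y) :
    IsSimpleSetFunction (imageAdjoint q ν) := fun A ↦ by
  rw [_root_.imageAdjoint]
  split_ifs with hA
  · exact hν _
  · exact IsZeroOne.biInf ⟨⟨Set.univ, .inl isOpen_univ⟩, isOpen_univ, Set.subset_univ _⟩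
      fun U ↦ hν (q U).toOpenOrClosed

theorem IsDImageTransformation.mono_of_isOpen (hq : IsDImageTransformation q)
    {U V : OpenOrCompact X} (hU : IsOpen U.1) (hV : IsOpen V.1) (hUV : U.1 ⊆ V.1) :
    (q U).1 ⊆ (q V).1 := by
  rw [hq.inner U hU, hq.inner V hV]
  exact Set.biUnion_mono (fun K hK ↦ ⟨hK.1, hK.2.trans hUV⟩) fun _ _ ↦ subset_rfl

theorem IsImageTransformation.isDImageTransformation (hq : IsImageTransformation q) :
    IsDImageTransformation q where
  isOpen := hq.isOpen
  isCompact := hq.isCompact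
  inner := hq.inner
  outer := hq.outer
  disjoint_union A B C _ _ := hq.disjoint_union A B C

variable [T2Space X]

/-- The equation `q = w⁻¹ ∘ Λ` for a family `μ` of simple set functions `μ y = w y`: a point `y`
lies in `q A` exactly when `μ y A = 1`. The `μ y` are plain set functions because the notion serves
to transfer the axioms of measures and of transformations to each other. -/
structure IsRepresentedBy (q : OpenOrCompact X → OpenOrCompact Y)
    (μ : Y → OpenOrClosed X → ℝ≥0∞) : Prop where
  simple : ∀ y, IsSimpleSetFunction (μ y)
  mem_iff : ∀ A y, y ∈ (q A).1 ↔ μ y A.toOpenOrClosed = 1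

namespace IsRepresentedBy

variable {μ : Y → OpenOrClosed X → ℝ≥0∞}

theorem eq_iUnion_iff (h : IsRepresentedBy q μ) (U : OpenOrCompact X) :
    (q U).1 = ⋃ (K : OpenOrCompact X) (_ : IsCompact K.1 ∧ K.1 ⊆ U.1), (q K).1 ↔
      ∀ y, μ y U.toOpenOrClosed =
        ⨆ (K : OpenOrClosed X) (_ : IsCompact K.1 ∧ K.1 ⊆ U.1), μ y K := by
  rw [Set.ext_iff]
  refine forall_congr' fun y ↦ ?_
  rw [(h.simple y).eq_biSup_iff]
  simp only [Set.mem_iUnion, h.mem_iff, exists_prop]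
  exact iff_congr .rfl ⟨fun ⟨K, hK, h1⟩ ↦ ⟨K.toOpenOrClosed, hK, h1⟩,
    fun ⟨K, hK, h1⟩ ↦ ⟨⟨K.1, .inr hK.1⟩, hK, h1⟩⟩

theorem eq_iInter_iff (h : IsRepresentedBy q μ) (K : OpenOrCompact X) :
    (q K).1 = ⋂ (U : OpenOrCompact X) (_ : IsOpen U.1 ∧ K.1 ⊆ U.1), (q U).1 ↔
      ∀ y, μ y K.toOpenOrClosed =
        ⨅ (U : OpenOrClosed X) (_ : IsOpen U.1 ∧ K.1 ⊆ U.1), μ y U := by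
  rw [Set.ext_iff]
  refine forall_congr' fun y ↦ ?_
  rw [(h.simple y).eq_biInf_iff _ (OpenOrClosed.exists_isOpen_superset K.1)]
  simp only [Set.mem_iInter, h.mem_iff]
  exact iff_congr .rfl ⟨fun h1 U hU ↦ h1 ⟨U.1, .inl hU.1⟩ hU, fun h1 U ↦ h1 U.toOpenOrClosed⟩

theorem disjoint_and_eq_union_iff (h : IsRepresentedBy q μ) (A B C : OpenOrCompact X) :
    Disjoint (q A).1 (q B).1 ∧ (q C).1 = (q A).1 ∪ (q B).1 ↔
      ∀ y, μ y C.toOpenOrClosed = μ y A.toOpenOrClosed + μ y B.toOpenOrClosed := by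
  rw [Set.disjoint_left, Set.ext_iff, ← forall_and]
  refine forall_congr' fun y ↦ ?_
  have hs := (h.simple y).isZeroOne
  rw [(hs _).eq_add_iff (hs _) (hs _)]
  simp only [Set.mem_union, h.mem_iff, ne_eq]

theorem isDImageTransformation (h : IsRepresentedBy q μ)
    (hμ : ∀ y, IsDeficientTopologicalMeasure (μ y))
    (hopen : ∀ U : OpenOrCompact X, IsOpen U.1 → IsOpen (q U).1)
    (hcompact : ∀ K : OpenOrCompact X, IsCompact K.1 → IsCompact (q K).1) :
    IsDImageTransformation q where
  isOpen := hopen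
  isCompact := hcompact
  inner U hU := (h.eq_iUnion_iff U).2 fun y ↦ (hμ y).inner _ hU
  outer K hK := (h.eq_iInter_iff K).2 fun y ↦ (hμ y).outer _ hK.isClosed
  disjoint_union A B C hA hB hAB hC :=
    (h.disjoint_and_eq_union_iff A B C).2 fun y ↦ (hμ y).add _ _ _ hA hB hAB hC

theorem isImageTransformation_iff (h : IsRepresentedBy q μ) (hq : IsDImageTransformation q)
    (hμ : ∀ y, IsDeficientTopologicalMeasure (μ y)) :
    IsImageTransformation q ↔ ∀ y, IsTopologicalMeasure (μ y) where
  mp hq' y :=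
    { exists_ne_top := (hμ y).exists_ne_top
      add := fun A B C hA hB hC hAB hABC ↦ (h.disjoint_and_eq_union_iff _ _ _).1
        (hq'.disjoint_union ⟨A.1, hA⟩ ⟨B.1, hB⟩ ⟨C.1, hC⟩ hAB hABC) y
      inner := (hμ y).inner
      outer := (hμ y).outer }
  mpr hμ' :=
    { isOpen := hq.isOpen
      isCompact := hq.isCompact
      inner := hq.inner
      outer := hq.outer
      disjoint_union := fun A B C hAB hC ↦ (h.disjoint_and_eq_union_iff A B C).2
        fun y ↦ (hμ' y).add _ _ _ A.2 B.2 C.2 hAB hC }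

end IsRepresentedBy

variable {S : Set (FiniteDTM X)} {w : Y → S}

theorem isRepresentedBy_of_eq_preimage (hS : S ⊆ SimpleDTM X)
    (h : ∀ A, (q A).1 = w ⁻¹' basicTransformation S A) : IsRepresentedBy q fun y ↦ (w y).1.1 where
  simple y := hS (w y).2
  mem_iff A y := by
    rw [h, Set.mem_preimage, mem_basicTransformation]

theorem exists_ne_empty_iff_exists_ne_zero (hS : S ⊆ SimpleDTM X)
    (h : ∀ A, (q A).1 = w ⁻¹' basicTransformation S A) :
    (∃ A, (q A).1 ≠ ∅) ↔ ∃ y A, (w y).1.1 A ≠ 0 := by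
  have hw := isRepresentedBy_of_eq_preimage hS h
  constructor
  · rintro ⟨A, hA⟩
    obtain ⟨y, hy⟩ := Set.nonempty_iff_ne_empty.2 hA
    exact ⟨y, A.toOpenOrClosed, by simp [(hw.mem_iff A y).1 hy]⟩
  · rintro ⟨y, A, hA⟩
    have hwhole : (w y).1.1 (.whole X) = 1 := ((hw.simple y).isZeroOne _).eq_one_of_le
      ((w y).1.2.1.mono (Set.subset_univ A.1)) ((hw.simple y A).resolve_left hA)
    exact ⟨⟨Set.univ, .inl isOpen_univ⟩, Set.Nonempty.ne_empty ⟨y, (hw.mem_iff _ y).2 hwhole⟩⟩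

theorem IsDImageTransformation.isKProper (hq : IsDImageTransformation q)
    (h : ∀ A, (q A).1 = w ⁻¹' basicTransformation S A) : IsKProper w :=
  fun K hK ↦ h K ▸ hq.isCompact K hK

/-- The transformation `w⁻¹ ∘ Λ` of a continuous k-proper map `w`. -/
def preimageTransformation [LocallyCompactSpace X] (hS : S ⊆ SimpleDTM X) (hc : Continuous w)
    (hk : IsKProper w) (A : OpenOrCompact X) : OpenOrCompact Y :=
  ⟨w ⁻¹' basicTransformation S A,
    A.2.imp (fun hA ↦ (isOpen_basicTransformation hS hA).preimage hc) (hk A)⟩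

theorem isDImageTransformation_preimageTransformation [LocallyCompactSpace X]
    (hS : S ⊆ SimpleDTM X) (hc : Continuous w) (hk : IsKProper w) :
    IsDImageTransformation (preimageTransformation hS hc hk) :=
  (isRepresentedBy_of_eq_preimage hS fun _ ↦ rfl).isDImageTransformation (fun y ↦ (w y).1.2.1)
    (fun _ hU ↦ (isOpen_basicTransformation hS hU).preimage hc) hk

variable [T2Space Y]

theorem imageAdjoint_pointMass_eq_one_iff (q : OpenOrCompact X → OpenOrCompact Y) (y : Y)
    (A : OpenOrCompact X) :
    imageAdjoint q (pointMass y).1 A.toOpenOrClosed = 1 ↔ y ∈ (q A).1 := by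
  rw [imageAdjoint_of_isOpen_or_isCompact q _ A.2, pointMass_eq_one_iff]
  rfl

theorem isRepresentedBy_imageAdjoint_pointMass (q : OpenOrCompact X → OpenOrCompact Y) :
    IsRepresentedBy q fun y ↦ imageAdjoint q (pointMass y).1 where
  simple y := (isSimpleSetFunction_pointMass y).imageAdjoint q
  mem_iff A y := (imageAdjoint_pointMass_eq_one_iff q y A).symm

theorem eq_preimage_of_eq_imageAdjoint (h : ∀ y, (w y).1.1 = imageAdjoint q (pointMass y).1)
    (A : OpenOrCompact X) : (q A).1 = w ⁻¹' basicTransformation S A := by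
  ext y
  rw [Set.mem_preimage, mem_basicTransformation, h, imageAdjoint_pointMass_eq_one_iff]

namespace IsDImageTransformation

theorem isDeficientTopologicalMeasure (hq : IsDImageTransformation q) (y : Y) :
    IsDeficientTopologicalMeasure (imageAdjoint q (pointMass y).1) := by
  have hrep := isRepresentedBy_imageAdjoint_pointMass q
  refine ⟨⟨.whole X, (hrep.simple y).ne_top _⟩, fun A B C hA hB hAB hC ↦ ?_, fun U hU ↦ ?_,
    fun F _ ↦ ?_⟩
  · have hC' : IsCompact C.1 := hC ▸ hA.union hB
    exact (hrep.disjoint_and_eq_union_iff _ _ _).1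
      (hq.disjoint_union ⟨A.1, .inr hA⟩ ⟨B.1, .inr hB⟩ ⟨C.1, .inr hC'⟩ hA hB hAB hC) y
  · exact (hrep.eq_iUnion_iff ⟨U.1, .inl hU⟩).1 (hq.inner _ hU) y
  · by_cases hFc : IsCompact F.1
    · exact (hrep.eq_iInter_iff ⟨F.1, .inr hFc⟩).1 (hq.outer _ hFc) y
    by_cases hFo : IsOpen F.1
    · refine ((hrep.simple y).eq_biInf_iff F (OpenOrClosed.exists_isOpen_superset F.1)).2
        ⟨fun h U hU ↦ ?_, fun h ↦ h F ⟨hFo, subset_rfl⟩⟩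
      exact (hrep.mem_iff ⟨U.1, .inl hU.1⟩ y).1 (hq.mono_of_isOpen (U := ⟨F.1, .inl hFo⟩) hFo hU.1
        hU.2 ((hrep.mem_iff ⟨F.1, .inl hFo⟩ y).2 h))
    · exact imageAdjoint_eq_biInf_of_not q _ (not_or.2 ⟨hFo, hFc⟩)

theorem exists_mem_simpleDTM (hq : IsDImageTransformation q) (y : Y) :
    ∃ μ ∈ SimpleDTM X, μ.1 = imageAdjoint q (pointMass y).1 :=
  have hs := (isSimpleSetFunction_pointMass y).imageAdjoint q
  ⟨⟨_, hq.isDeficientTopologicalMeasure y, hs.ne_top _⟩, hs, rfl⟩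

theorem continuous (hq : IsDImageTransformation q) (hS : S ⊆ SimpleDTM X)
    (h : ∀ A, (q A).1 = w ⁻¹' basicTransformation S A) : Continuous w :=
  continuous_of_isOpen_of_isClosed hS (fun U hU ↦ h U ▸ hq.isOpen U hU)
    fun K hK ↦ h K ▸ (hq.isCompact K hK).isClosed

theorem eq_imageAdjoint (hq : IsDImageTransformation q) (hS : S ⊆ SimpleDTM X)
    (h : ∀ A, (q A).1 = w ⁻¹' basicTransformation S A) (y : Y) :
    (w y).1.1 = imageAdjoint q (pointMass y).1 := by
  have hw := isRepresentedBy_of_eq_preimage hS h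
  have hq' := isRepresentedBy_imageAdjoint_pointMass q
  refine (w y).1.2.1.eq_of_forall_isOpen (hq.isDeficientTopologicalMeasure y) fun U hU ↦ ?_
  rw [((hw.simple y).isZeroOne U).eq_iff ((hq'.simple y).isZeroOne U)]
  exact (hw.mem_iff ⟨U.1, .inl hU⟩ y).symm.trans (hq'.mem_iff ⟨U.1, .inl hU⟩ y)

end IsDImageTransformation

theorem isImageTransformation_iff_exists_mem_simpleTM : IsImageTransformation q ↔
    IsDImageTransformation q ∧ ∀ y, ∃ μ ∈ SimpleTM X, μ.1 = imageAdjoint q (pointMass y).1 := by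
  have hrep := isRepresentedBy_imageAdjoint_pointMass q
  constructor
  · intro hq
    have hd := hq.isDImageTransformation
    have hμ := (hrep.isImageTransformation_iff hd hd.isDeficientTopologicalMeasure).1 hq
    exact ⟨hd, fun y ↦
      ⟨⟨_, (hμ y).deficient, (hrep.simple y).ne_top _⟩, ⟨hμ y, hrep.simple y⟩, rfl⟩⟩
  · rintro ⟨hd, hμ⟩
    refine (hrep.isImageTransformation_iff hd hd.isDeficientTopologicalMeasure).2 fun y ↦ ?_
    obtain ⟨μ, hμS, hμq⟩ := hμ y
    exact hμq ▸ hμS.1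

theorem exists_equiv_transformation (hS : S ⊆ SimpleDTM X)
    {P : (OpenOrCompact X → OpenOrCompact Y) → Prop}
    (hmap : ∀ q, P q → ∃ w : Y → S, (∀ y, (w y).1.1 = imageAdjoint q (pointMass y).1) ∧
      Continuous w ∧ IsKProper w ∧ ∀ A, (q A).1 = w ⁻¹' basicTransformation S A)
    (hinv : ∀ w : Y → S, Continuous w → IsKProper w → ∃ q : OpenOrCompact X → OpenOrCompact Y,
      (∀ A, (q A).1 = w ⁻¹' basicTransformation S A) ∧ P q ∧
        ∀ y, (w y).1.1 = imageAdjoint q (pointMass y).1) :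
    ∃ e : {q : OpenOrCompact X → OpenOrCompact Y // P q} ≃
        {w : Y → S // Continuous w ∧ IsKProper w},
      (∀ q A, (q.1 A).1 = (e q).1 ⁻¹' basicTransformation S A) ∧
      (∀ q y, ((e q).1 y).1.1 = imageAdjoint q.1 (pointMass y).1) ∧
      ∀ q, (∃ A, (q.1 A).1 ≠ ∅) ↔ ∃ y A, ((e q).1 y).1.1 A ≠ 0 := by
  choose F hFadj hFc hFk hFpre using hmap
  choose G hGpre hGP hGadj using hinv
  refine ⟨⟨fun q ↦ ⟨F q.1 q.2, hFc q.1 q.2, hFk q.1 q.2⟩,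
    fun w ↦ ⟨G w.1 w.2.1 w.2.2, hGP w.1 w.2.1 w.2.2⟩, fun q ↦ ?_, fun w ↦ ?_⟩,
    fun q ↦ hFpre q.1 q.2, fun q ↦ hFadj q.1 q.2,
    fun q ↦ exists_ne_empty_iff_exists_ne_zero hS (hFpre q.1 q.2)⟩
  · refine Subtype.ext (funext fun A ↦ Subtype.ext ?_)
    exact (hGpre _ _ _ A).trans (hFpre q.1 q.2 A).symm
  · refine Subtype.ext (funext fun y ↦ Subtype.ext (Subtype.ext ?_))
    exact (hFadj _ _ y).trans (hGadj w.1 w.2.1 w.2.2 y).symm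

/-- For `S = X^♭` the class `P` is that of all d-image transformations, for `S = X^♯` that of all
image transformations. -/
theorem mainTheorem2_general [LocallyCompactSpace X] {S : Set (FiniteDTM X)}
    (hS : S ⊆ SimpleDTM X) {P : (OpenOrCompact X → OpenOrCompact Y) → Prop}
    (hP : ∀ q, P q ↔
      IsDImageTransformation q ∧ ∀ y, ∃ μ ∈ S, μ.1 = imageAdjoint q (pointMass y).1) :
    (∀ q : OpenOrCompact X → OpenOrCompact Y, P q →
      ∃ w : Y → S, (∀ y, (w y).1.1 = imageAdjoint q (pointMass y).1) ∧ Continuous w ∧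
        IsKProper w ∧ ∀ A, (q A).1 = w ⁻¹' basicTransformation S A) ∧
    (∀ w : Y → S, Continuous w → IsKProper w →
      ∃ q : OpenOrCompact X → OpenOrCompact Y,
        (∀ A, (q A).1 = w ⁻¹' basicTransformation S A) ∧ P q ∧
          ∀ y, (w y).1.1 = imageAdjoint q (pointMass y).1) ∧
    ∃ e : {q : OpenOrCompact X → OpenOrCompact Y // P q} ≃
        {w : Y → S // Continuous w ∧ IsKProper w},
      (∀ q A, (q.1 A).1 = (e q).1 ⁻¹' basicTransformation S A) ∧
      (∀ q y, ((e q).1 y).1.1 = imageAdjoint q.1 (pointMass y).1) ∧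
      ∀ q, (∃ A, (q.1 A).1 ≠ ∅) ↔ ∃ y A, ((e q).1 y).1.1 A ≠ 0 := by
  refine ⟨?hmap, ?hinv, exists_equiv_transformation hS ?hmap ?hinv⟩
  case hmap =>
    intro q hPq
    obtain ⟨hq, hμ⟩ := (hP q).1 hPq
    choose μ hμS hadj using hμ
    let w : Y → S := fun y ↦ ⟨μ y, hμS y⟩
    have hpre := eq_preimage_of_eq_imageAdjoint (w := w) hadj
    exact ⟨w, hadj, hq.continuous hS hpre, hq.isKProper hpre, hpre⟩
  case hinv =>
    intro w hc hk
    have hq := isDImageTransformation_preimageTransformation hS hc hk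
    have hadj := hq.eq_imageAdjoint hS fun _ ↦ rfl
    exact ⟨_, fun _ ↦ rfl, (hP _).2 ⟨hq, fun y ↦ ⟨(w y).1, (w y).2, hadj y⟩⟩, hadj⟩

end Transformations

theorem mainTheorem2 {X Y : Type*} [TopologicalSpace X] [T2Space X] [LocallyCompactSpace X]
    [TopologicalSpace Y] [T2Space Y] [LocallyCompactSpace Y] :
    -- d-image transformations and `X^♭`
    ((∀ q : OpenOrCompact X → OpenOrCompact Y, IsDImageTransformation q →
        ∃ w : Y → SimpleDTM X,
          (∀ y, (w y).1.1 = imageAdjoint q (pointMass y).1) ∧ Continuous w ∧ IsKProper w ∧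
            ∀ A, (q A).1 = w ⁻¹' basicTransformation (SimpleDTM X) A) ∧
      (∀ w : Y → SimpleDTM X, Continuous w → IsKProper w →
        ∃ q : OpenOrCompact X → OpenOrCompact Y,
          (∀ A, (q A).1 = w ⁻¹' basicTransformation (SimpleDTM X) A) ∧
            IsDImageTransformation q ∧ ∀ y, (w y).1.1 = imageAdjoint q (pointMass y).1) ∧
      ∃ e : {q : OpenOrCompact X → OpenOrCompact Y // IsDImageTransformation q} ≃
          {w : Y → SimpleDTM X // Continuous w ∧ IsKProper w},
        (∀ q A, (q.1 A).1 = (e q).1 ⁻¹' basicTransformation (SimpleDTM X) A) ∧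
        (∀ q y, ((e q).1 y).1.1 = imageAdjoint q.1 (pointMass y).1) ∧
        ∀ q, (∃ A, (q.1 A).1 ≠ ∅) ↔ ∃ y A, ((e q).1 y).1.1 A ≠ 0) ∧
    -- image transformations and `X^♯`
    ((∀ q : OpenOrCompact X → OpenOrCompact Y, IsImageTransformation q →
        ∃ w : Y → SimpleTM X,
          (∀ y, (w y).1.1 = imageAdjoint q (pointMass y).1) ∧ Continuous w ∧ IsKProper w ∧
            ∀ A, (q A).1 = w ⁻¹' basicTransformation (SimpleTM X) A) ∧
      (∀ w : Y → SimpleTM X, Continuous w → IsKProper w →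
        ∃ q : OpenOrCompact X → OpenOrCompact Y,
          (∀ A, (q A).1 = w ⁻¹' basicTransformation (SimpleTM X) A) ∧
            IsImageTransformation q ∧ ∀ y, (w y).1.1 = imageAdjoint q (pointMass y).1) ∧
      ∃ e : {q : OpenOrCompact X → OpenOrCompact Y // IsImageTransformation q} ≃
          {w : Y → SimpleTM X // Continuous w ∧ IsKProper w},
        (∀ q A, (q.1 A).1 = (e q).1 ⁻¹' basicTransformation (SimpleTM X) A) ∧
        (∀ q y, ((e q).1 y).1.1 = imageAdjoint q.1 (pointMass y).1) ∧
        ∀ q, (∃ A, (q.1 A).1 ≠ ∅) ↔ ∃ y A, ((e q).1 y).1.1 A ≠ 0) :=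
  ⟨mainTheorem2_general subset_rfl fun _ ↦
      (and_iff_left_of_imp IsDImageTransformation.exists_mem_simpleDTM).symm,
    mainTheorem2_general (fun _ h ↦ h.2) fun _ ↦ isImageTransformation_iff_exists_mem_simpleTM⟩
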